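/- Let $\mathcal H$ be a separable complex Hilbert space, let $n\in\{2,3,\dots\}$ or $n=\infty$, and let $\{A_i\}_{i=1}^n$ be a family of bounded operators on $\mathcal H$ such that for every $X\in B(\mathcal H)$ the sum $$\varphi(X)=\sum_{i=1}^n A_iXA_i^*$$ exists in $B(\mathcal H)$, where for $n=\infty$ convergence is in the $w^*$-topology; thus $\varphi$ is a $w^*$-continuous completely positive linear map on $B(\mathcal H)$. Let $\mathcal O_n$ be the Cuntz algebra, i.e. the universal unital $C^*$-algebra generated by elements $v_1,\dots,v_n$ (a sequence $v_1,v_2,\dots$ if $n=\infty$) subject to the relations $v_i^*v_j=\delta_{ij}I$ and, if $n<\infty$, $\sum_{i=1}^n v_iv_i^*=I$. Let $\mathbb F_n^+$ be the free semigroup with generators $g_i$, $1\le i\le n$ (all $i\ge 1$ if $n=\infty$), and neutral element $g_0$. For $\alpha=g_{i_1}\cdots g_{i_k}$ put $A_\alpha=A_{i_1}\cdots A_{i_k}$, $v_\alpha=v_{i_1}\cdots v_{i_k}$, and put $A_{g_0}=I$, $v_{g_0}=I$. 1. If $D\in B(\mathcal H)$ is positive and invertible and $\varphi(D)=D$, then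 there is a unique completely positive linear map $\Phi_{\varphi,D}:\mathcal O_n\to B(\mathcal H)$ such that $\Phi_{\varphi,D}(I)=D$ and $$\Phi_{\varphi,D}(v_\alpha v_\beta^*)=A_\alpha DA_\beta^*\qquad\text{for all }\alpha,\beta\in\mathbb F_n^+.$$ 2. If $\varphi(I)=I$, then the same conclusion holds for every positive $D\in B(\mathcal H)$ with $\varphi(D)=D$, invertible or not. -/

import Mathlib

open scoped CStarAlgebra ENNReal InnerProductSpace

universe u

noncomputable section

/-- The Cuntz relations for a family `v` in a unital C⋆-algebra: `vᵢ⋆ vⱼ = δᵢⱼ 1`, and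
`∑ᵢ vᵢ vᵢ⋆ = 1` when the index set is finite.  (For an infinite index set the second relation is
omitted, as is standard for `𝒪_∞`.) -/
structure IsCuntzFamily {ι : Type} {B : Type*} [CStarAlgebra B] (v : ι → B) : Prop where
  star_mul_self (i : ι) : star (v i) * v i = 1
  star_mul_of_ne (i j : ι) (h : i ≠ j) : star (v i) * v j = 0
  sum_mul_star [Fintype ι] : ∑ i, v i * star (v i) = 1

/-- A model of the Cuntz relations: a nonzero unital C⋆-algebra with a Cuntz family in it. -/
structure CuntzModel (ι : Type) : Type (u + 1) where
  carrier : Type u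
  [cstar : CStarAlgebra carrier]
  [nontriv : Nontrivial carrier]
  v : ι → carrier
  isCuntz : IsCuntzFamily v

attribute [instance] CuntzModel.cstar CuntzModel.nontriv

/-- The C⋆-algebra of bounded families `(b_r)`, one `b_r` in each model `r` of the Cuntz relations,
with the supremum norm. -/
abbrev CuntzProduct (ι : Type) : Type (u + 1) :=
  lp (fun r : CuntzModel.{u} ι => r.carrier) ∞

instance CuntzProduct.instCStarAlgebra (ι : Type) : CStarAlgebra (CuntzProduct.{u} ι) where

theorem CuntzModel.norm_v_le {ι : Type} (r : CuntzModel.{u} ι) (i : ι) : ‖r.v i‖ ≤ 1 := by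
  have h := CStarRing.norm_star_mul_self (x := r.v i)
  rw [r.isCuntz.star_mul_self, CStarRing.norm_one] at h
  nlinarith [norm_nonneg (r.v i)]

/-- The family of all `i`-th generators of all models. -/
def CuntzProduct.v {ι : Type} (i : ι) : CuntzProduct.{u} ι :=
  ⟨fun r => r.v i, memℓp_infty ⟨1, by rintro _ ⟨r, rfl⟩; exact r.norm_v_le i⟩⟩

/-- The unital C⋆-algebra generated by the `CuntzProduct.v i`. -/
def cuntzSubalgebra (ι : Type) : StarSubalgebra ℂ (CuntzProduct.{u} ι) :=
  (StarAlgebra.adjoin ℂ (Set.range (CuntzProduct.v.{u} (ι := ι)))).topologicalClosure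

/-- The Cuntz algebra `𝒪_n`, with `n` the cardinality of `ι`: the universal unital C⋆-algebra
generated by a Cuntz family, that is, the closed unital ⋆-algebra generated by the canonical family
in the product of all models of the relations.  Its universal property is proved in
`CuntzAlgebra.existsUnique_lift`. -/
def CuntzAlgebra (ι : Type) : Type (u + 1) := cuntzSubalgebra.{u} ι

namespace CuntzAlgebra

instance instIsClosed (ι : Type) : IsClosed (cuntzSubalgebra.{u} ι : Set (CuntzProduct.{u} ι)) :=
  StarSubalgebra.isClosed_topologicalClosure _

instance instCStarAlgebra (ι : Type) : CStarAlgebra (CuntzAlgebra.{u} ι) :=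
  inferInstanceAs (CStarAlgebra (cuntzSubalgebra.{u} ι))

/-- The usual order of a C⋆-algebra. -/
instance instPartialOrder (ι : Type) : PartialOrder (CuntzAlgebra.{u} ι) :=
  CStarAlgebra.spectralOrder _

instance instStarOrderedRing (ι : Type) : StarOrderedRing (CuntzAlgebra.{u} ι) :=
  CStarAlgebra.spectralOrderedRing _

/-- The canonical generators `vᵢ` of the Cuntz algebra. -/
def v {ι : Type} (i : ι) : CuntzAlgebra.{u} ι :=
  ⟨CuntzProduct.v i, StarSubalgebra.le_topologicalClosure _
    (StarAlgebra.subset_adjoin ℂ _ (Set.mem_range_self i))⟩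

/-- The component of an element of the Cuntz algebra in a given model, as a unital
⋆-homomorphism. -/
def eval {ι : Type} (r : CuntzModel.{u} ι) : CuntzAlgebra.{u} ι →⋆ₐ[ℂ] r.carrier where
  toFun x := (x : cuntzSubalgebra.{u} ι).1 r
  map_one' := rfl
  map_mul' _ _ := rfl
  map_zero' := rfl
  map_add' _ _ := rfl
  commutes' _ := rfl
  map_star' _ := rfl

theorem ext_eval {ι : Type} {x y : CuntzAlgebra.{u} ι} (h : ∀ r, eval r x = eval r y) :
    x = y :=
  Subtype.ext (lp.ext (funext h))

theorem isCuntzFamily_v (ι : Type) : IsCuntzFamily (v.{u} (ι := ι)) where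
  star_mul_self i := ext_eval fun r => by
    rw [map_mul, map_star, map_one]; exact r.isCuntz.star_mul_self i
  star_mul_of_ne i j h := ext_eval fun r => by
    rw [map_mul, map_star, map_zero]; exact r.isCuntz.star_mul_of_ne i j h
  sum_mul_star := ext_eval fun r => by
    simp only [map_sum, map_mul, map_star, map_one]; exact r.isCuntz.sum_mul_star

/-- The generators generate: the unital ⋆-algebra that they generate is dense. -/
theorem topologicalClosure_adjoin_v (ι : Type) :
    (StarAlgebra.adjoin ℂ (Set.range (v.{u} (ι := ι)))).topologicalClosure = ⊤ := by
  let j : CuntzAlgebra.{u} ι →⋆ₐ[ℂ] CuntzProduct.{u} ι := (cuntzSubalgebra.{u} ι).subtype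
  have hj : StarAlgebra.adjoin ℂ (Set.range (CuntzProduct.v.{u} (ι := ι))) =
      (StarAlgebra.adjoin ℂ (Set.range (v.{u} (ι := ι)))).map j := by
    rw [StarAlgHom.map_adjoin, ← Set.range_comp]
    rfl
  refine eq_top_iff.2 fun x _ => ?_
  have hx : j x ∈
      (StarAlgebra.adjoin ℂ (Set.range (CuntzProduct.v.{u} (ι := ι)))).topologicalClosure :=
    Subtype.property (p := fun y => y ∈ cuntzSubalgebra.{u} ι) x
  rw [hj, ← SetLike.mem_coe, StarSubalgebra.topologicalClosure_coe, StarSubalgebra.coe_map] at hx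
  rw [← SetLike.mem_coe, StarSubalgebra.topologicalClosure_coe]
  have hind : Topology.IsInducing j := ⟨rfl⟩
  rw [hind.closure_eq_preimage_closure_image]
  exact hx

/-- The universal property of the Cuntz algebra. -/
theorem existsUnique_lift {ι : Type} {B : Type u} [CStarAlgebra B] (w : ι → B)
    (hw : IsCuntzFamily w) :
    ∃! f : CuntzAlgebra.{u} ι →⋆ₐ[ℂ] B, ∀ i, f (v i) = w i := by
  refine existsUnique_of_exists_of_unique ?_ fun f g hf hg => ?_
  · rcases subsingleton_or_nontrivial B with hB | hB
    · exact ⟨{ toFun := fun _ => 0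
               map_one' := Subsingleton.elim _ _
               map_mul' := fun _ _ => Subsingleton.elim _ _
               map_zero' := rfl
               map_add' := fun _ _ => Subsingleton.elim _ _
               commutes' := fun _ => Subsingleton.elim _ _
               map_star' := fun _ => Subsingleton.elim _ _ }, fun _ => Subsingleton.elim _ _⟩
    · exact ⟨eval { carrier := B, v := w, isCuntz := hw }, fun _ => rfl⟩
  · have hc : IsClosed (StarAlgHom.equalizer f g : Set (CuntzAlgebra.{u} ι)) :=
      isClosed_eq (map_continuous f) (map_continuous g)
    have hle := StarSubalgebra.topologicalClosure_minimal (StarAlgHom.adjoin_le_equalizer f g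
      (s := Set.range v) (by rintro _ ⟨i, rfl⟩; exact (hf i).trans (hg i).symm)) hc
    rw [topologicalClosure_adjoin_v] at hle
    exact DFunLike.ext f g fun x => hle (StarSubalgebra.mem_top (R := ℂ) (x := x))

end CuntzAlgebra

/-- Convergence of the series `∑ᵢ fᵢ` to `s` in the w⋆-topology (the ultraweak topology) of the
bounded operators on `H`, that is, the topology given by the functionals `X ↦ ∑ₖ ⟪yₖ, X xₖ⟫` with
`(xₖ)`, `(yₖ)` square summable sequences of vectors. -/
def HasUltraweakSum {ι H : Type*} [NormedAddCommGroup H] [InnerProductSpace ℂ H]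
    (f : ι → H →L[ℂ] H) (s : H →L[ℂ] H) : Prop :=
  ∀ x y : lp (fun _ : ℕ => H) 2,
    HasSum (fun i => ∑' k, ⟪y k, f i (x k)⟫_ℂ) (∑' k, ⟪y k, s (x k)⟫_ℂ)

/-- The product `T_α = T_{i₁} ⋯ T_{iₖ}` along a word `α = g_{i₁} ⋯ g_{iₖ}` of the free semigroup
on `ι`; the empty word gives `1`. -/
def wordProd {ι M : Type*} [Monoid M] (T : ι → M) (α : FreeMonoid ι) : M := FreeMonoid.lift T α

end

/-!
With `S = √D`, the identity `D = ∑ᵢ Aᵢ D Aᵢ⋆` says `∑ᵢ ‖S Aᵢ⋆ h‖² = ‖S h‖²`, so `S h ↦ (S Aᵢ⋆ h)ᵢ`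
extends to an isometry `C : E → ℓ²(ι, E)` on the closure `E` of the range of `S`. Let `𝒟` be the
orthogonal complement of `ran C` and `K = E ⊕ ℓ²(words, 𝒟)`. Since `ℓ²(ι, E) = ran C ⊕ 𝒟`, sending
the value at the empty word to `𝒟` and splitting the other words by their first letter extends `C`
to a unitary `K → ℓ²(ι, K)`, whose components are the adjoints `Vᵢ⋆` of a Cuntz family. Then
`R : h ↦ S h ∈ K` satisfies `Vᵢ⋆ R = R Aᵢ⋆` and `R⋆ R = D`, so `x ↦ R⋆ π(x) R` has the required
values, where `π` is the representation of the Cuntz algebra given by `V`. It is the only such map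
because the `v_α v_β⋆` span a dense subspace.
-/

section LpColumn

variable {𝕜 ι X F : Type*} [RCLike 𝕜] [AddCommGroup X] [Module 𝕜 X]
  [NormedAddCommGroup F] [NormedSpace 𝕜 F]

theorem hasSum_norm_sq_lp {ι : Type*} {E : ι → Type*} [∀ i, NormedAddCommGroup (E i)]
    (f : lp E 2) : HasSum (fun i => ‖f i‖ ^ 2) (‖f‖ ^ 2) := by
  simpa only [ENNReal.toReal_ofNat, Real.rpow_ofNat] using lp.hasSum_norm (by norm_num) f

theorem memℓp_two_of_summable {ι : Type*} {E : ι → Type*} [∀ i, NormedAddCommGroup (E i)]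
    {f : ∀ i, E i} (hf : Summable fun i => ‖f i‖ ^ 2) : Memℓp f 2 :=
  memℓp_gen (by simpa only [ENNReal.toReal_ofNat, Real.rpow_ofNat] using hf)

/-- The column `x ↦ (Tᵢ x)ᵢ` of a pointwise square summable family of linear maps. -/
noncomputable def lpColumn (T : ι → X →ₗ[𝕜] F) (hT : ∀ x, Summable fun i => ‖T i x‖ ^ 2) :
    X →ₗ[𝕜] lp (fun _ : ι => F) 2 where
  toFun x := ⟨fun i => T i x, memℓp_two_of_summable (hT x)⟩
  map_add' _ _ := lp.ext (funext fun i => map_add (T i) _ _)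
  map_smul' _ _ := lp.ext (funext fun i => map_smul (T i) _ _)

theorem norm_lpColumn_of_hasSum {T : ι → X →ₗ[𝕜] F} {hT : ∀ x, Summable fun i => ‖T i x‖ ^ 2}
    {x : X} {r : ℝ} (hr : 0 ≤ r) (h : HasSum (fun i => ‖T i x‖ ^ 2) (r ^ 2)) :
    ‖lpColumn T hT x‖ = r :=
  (sq_eq_sq₀ (norm_nonneg _) hr).1 ((hasSum_norm_sq_lp (lpColumn T hT x)).unique h)

end LpColumn

section WordSlice

variable {𝕜 ι G : Type*} [RCLike 𝕜] [NormedAddCommGroup G] [NormedSpace 𝕜 G]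

theorem hasSum_cons_iff {F : List ι → ℝ} {a : ℝ} :
    HasSum (fun p : ι × List ι => F (p.1 :: p.2)) a ↔ HasSum F (F [] + a) := by
  classical
  have hinj : Function.Injective fun p : ι × List ι => p.1 :: p.2 := fun p q h =>
    Prod.ext (List.cons.inj h).1 (List.cons.inj h).2
  have hnil : ∀ w ∉ Set.range fun p : ι × List ι => p.1 :: p.2, Function.update F [] 0 w = 0 := by
    rintro (_ | ⟨i, w⟩) hw
    · exact Function.update_self ..
    · exact absurd ⟨(i, w), rfl⟩ hw
  have hcons := hinj.hasSum_iff (a := a) hnil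
  simp only [Function.comp_def, ne_eq, reduceCtorEq, not_false_eq_true, Function.update_of_ne]
    at hcons
  rw [hcons]
  refine ⟨fun h => ?_, fun h => ?_⟩
  · simpa using h.update [] (F [])
  · simpa using h.update [] 0

variable (𝕜) in
/-- The slice `w ↦ f (i :: w)` of a square summable family indexed by words. -/
noncomputable def wordSlice (i : ι) :
    lp (fun _ : List ι => G) 2 →ₗ[𝕜] lp (fun _ : List ι => G) 2 where
  toFun f := ⟨fun w => f (i :: w), memℓp_two_of_summable
    ((hasSum_norm_sq_lp f).summable.comp_injective List.cons_injective)⟩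
  map_add' _ _ := rfl
  map_smul' _ _ := rfl

theorem hasSum_norm_sq_wordSlice (f : lp (fun _ : List ι => G) 2) :
    HasSum (fun i => ‖wordSlice 𝕜 i f‖ ^ 2) (‖f‖ ^ 2 - ‖f []‖ ^ 2) := by
  have h : HasSum (fun p : ι × List ι => ‖f (p.1 :: p.2)‖ ^ 2) (‖f‖ ^ 2 - ‖f []‖ ^ 2) := by
    rw [hasSum_cons_iff (F := fun w => ‖f w‖ ^ 2), add_sub_cancel]
    exact hasSum_norm_sq_lp f
  exact h.prod_fiberwise fun i => hasSum_norm_sq_lp (wordSlice 𝕜 i f)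

theorem exists_wordSlice_eq (d : G) (g : lp (fun _ : ι => lp (fun _ : List ι => G) 2) 2) :
    ∃ f : lp (fun _ : List ι => G) 2, f [] = d ∧ ∀ i, wordSlice 𝕜 i f = g i := by
  let f : List ι → G
    | [] => d
    | i :: w => g i w
  have hcons : Summable fun p : ι × List ι => ‖f (p.1 :: p.2)‖ ^ 2 := by
    refine (summable_prod_of_nonneg fun _ => sq_nonneg _).2
      ⟨fun i => (hasSum_norm_sq_lp (g i)).summable, ?_⟩
    simpa only [f, (hasSum_norm_sq_lp (g _)).tsum_eq] using (hasSum_norm_sq_lp g).summable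
  have hf : Summable fun w => ‖f w‖ ^ 2 :=
    (hasSum_cons_iff (F := fun w => ‖f w‖ ^ 2).1 hcons.hasSum).summable
  exact ⟨⟨f, memℓp_two_of_summable hf⟩, rfl, fun i => rfl⟩

end WordSlice

section Dilation

variable {𝕜 ι E : Type*} [RCLike 𝕜] [NormedAddCommGroup E] [InnerProductSpace 𝕜 E]

/-- The defect space of an isometry `C : E → ℓ²(ι, E)`: the orthogonal complement of its range. -/
noncomputable abbrev defectSpace (C : E →ₗᵢ[𝕜] lp (fun _ : ι => E) 2) :
    Submodule 𝕜 (lp (fun _ : ι => E) 2) :=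
  (LinearMap.range C.toLinearMap)ᗮ

/-- The space `E ⊕ ℓ²(List ι, 𝒟)`, with `𝒟` the defect space of `C`, on which `C` dilates to a
unitary. -/
abbrev DilationSpace (C : E →ₗᵢ[𝕜] lp (fun _ : ι => E) 2) : Type _ :=
  WithLp 2 (E × lp (fun _ : List ι => defectSpace C) 2)

/-- The component `(x, f) ↦ ((C x)ᵢ + (f [])ᵢ, w ↦ f (i :: w))` of the dilation of `C`. -/
noncomputable def dilationComponent (C : E →ₗᵢ[𝕜] lp (fun _ : ι => E) 2) (i : ι) :
    DilationSpace C →ₗ[𝕜] DilationSpace C where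
  toFun y := WithLp.toLp 2
    (C y.fst i + (y.snd [] : lp (fun _ : ι => E) 2) i, wordSlice 𝕜 i y.snd)
  map_add' y z := by
    refine congrArg (WithLp.toLp 2) (Prod.ext ?_ (map_add (wordSlice 𝕜 i) y.snd z.snd))
    simp [add_add_add_comm]
  map_smul' c y := by
    refine congrArg (WithLp.toLp 2) (Prod.ext ?_ (map_smul (wordSlice 𝕜 i) c y.snd))
    simp

variable (C : E →ₗᵢ[𝕜] lp (fun _ : ι => E) 2)

theorem hasSum_norm_sq_dilationComponent (y : DilationSpace C) :
    HasSum (fun i => ‖dilationComponent C i y‖ ^ 2) (‖y‖ ^ 2) := by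
  let d : lp (fun _ : ι => E) 2 := y.snd []
  have horth : inner 𝕜 (C y.fst) d = 0 := (y.snd []).2 _ ⟨y.fst, rfl⟩
  have hd : ‖C y.fst + d‖ ^ 2 = ‖y.fst‖ ^ 2 + ‖y.snd []‖ ^ 2 := by
    rw [sq, norm_add_sq_eq_norm_sq_add_norm_sq_of_inner_eq_zero _ _ horth, C.norm_map, ← sq, ← sq]
    rfl
  have h := (hasSum_norm_sq_lp (C y.fst + d)).add (hasSum_norm_sq_wordSlice (𝕜 := 𝕜) y.snd)
  rw [hd, add_add_sub_cancel, ← WithLp.prod_norm_sq_eq_of_L2] at h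
  exact h.congr_fun fun i => WithLp.prod_norm_sq_eq_of_L2 _

theorem exists_dilationComponent_eq [CompleteSpace E] (g : lp (fun _ : ι => DilationSpace C) 2) :
    ∃ y, ∀ i, dilationComponent C i y = g i := by
  have hg : Summable fun i => ‖(g i).fst‖ ^ 2 + ‖(g i).snd‖ ^ 2 := by
    simpa only [WithLp.prod_norm_sq_eq_of_L2] using (hasSum_norm_sq_lp g).summable
  let g₁ : lp (fun _ : ι => E) 2 := ⟨fun i => (g i).fst, memℓp_two_of_summable
    (hg.of_nonneg_of_le (fun _ => sq_nonneg _) fun _ => le_add_of_nonneg_right (sq_nonneg _))⟩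
  let g₂ : lp (fun _ : ι => lp (fun _ : List ι => defectSpace C) 2) 2 :=
    ⟨fun i => (g i).snd, memℓp_two_of_summable
      (hg.of_nonneg_of_le (fun _ => sq_nonneg _) fun _ => le_add_of_nonneg_left (sq_nonneg _))⟩
  have : CompleteSpace (LinearMap.range C.toLinearMap) :=
    C.isometry.isUniformInducing.isComplete_range.completeSpace_coe
  obtain ⟨_, ⟨x, rfl⟩, d, hd, hxd⟩ :=
    (LinearMap.range C.toLinearMap).exists_add_mem_mem_orthogonal g₁
  obtain ⟨f, hf, hfg⟩ := exists_wordSlice_eq (𝕜 := 𝕜) ⟨d, hd⟩ g₂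
  refine ⟨WithLp.toLp 2 (x, f), fun i => ?_⟩
  have hfst : C x i + (f [] : lp (fun _ : ι => E) 2) i = (g i).fst := by
    rw [hf]
    exact congrArg (fun z : lp (fun _ : ι => E) 2 => z i) hxd.symm
  exact congrArg (WithLp.toLp 2) (Prod.ext hfst (hfg i))

/-- The unitary `K ≃ ℓ²(ι, K)` on the dilation space that extends `C`. -/
noncomputable def dilationEquiv [CompleteSpace E] :
    DilationSpace C ≃ₗᵢ[𝕜] lp (fun _ : ι => DilationSpace C) 2 :=
  .ofSurjective
    { toLinearMap := lpColumn (dilationComponent C) fun y =>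
        (hasSum_norm_sq_dilationComponent C y).summable
      norm_map' := fun y =>
        norm_lpColumn_of_hasSum (norm_nonneg y) (hasSum_norm_sq_dilationComponent C y) }
    fun g => (exists_dilationComponent_eq C g).imp fun _ hy => lp.ext (funext hy)

theorem dilationEquiv_toLp_zero [CompleteSpace E] (x : E) (i : ι) :
    dilationEquiv C (WithLp.toLp 2 (x, 0)) i = WithLp.toLp 2 (C x i, 0) :=
  congrArg (WithLp.toLp 2) (Prod.ext (add_zero (C x i)) (map_zero (wordSlice 𝕜 i)))

end Dilation

section CuntzDilation

open ContinuousLinearMap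

variable {ι K : Type*} [NormedAddCommGroup K] [InnerProductSpace ℂ K]

/-- The components `K → K` of the unitary `U⁻¹ : ℓ²(ι, K) → K`. -/
noncomputable def rowComponent [DecidableEq ι] (U : K ≃ₗᵢ[ℂ] lp (fun _ : ι => K) 2) (i : ι) :
    K →L[ℂ] K :=
  (U.symm.toContinuousLinearEquiv : _ →L[ℂ] K) ∘L
    lp.singleContinuousLinearMap ℂ (fun _ : ι => K) 2 i

theorem rowComponent_apply [DecidableEq ι] (U : K ≃ₗᵢ[ℂ] lp (fun _ : ι => K) 2) (i : ι) (y : K) :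
    rowComponent U i y = U.symm (lp.single 2 i y) := rfl

variable [CompleteSpace K]

theorem star_rowComponent_apply [DecidableEq ι] (U : K ≃ₗᵢ[ℂ] lp (fun _ : ι => K) 2) (i : ι)
    (x : K) : star (rowComponent U i) x = U x i := by
  refine ext_inner_right ℂ fun y => ?_
  rw [star_eq_adjoint, adjoint_inner_left, rowComponent_apply, ← U.inner_map_map,
    U.apply_symm_apply, lp.inner_single_right]

theorem isCuntzFamily_rowComponent {ι : Type} [DecidableEq ι]
    (U : K ≃ₗᵢ[ℂ] lp (fun _ : ι => K) 2) : IsCuntzFamily (rowComponent U) where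
  star_mul_self i := by
    ext x
    rw [mul_apply_eq_comp, star_rowComponent_apply, rowComponent_apply,
      U.apply_symm_apply, lp.single_apply_self, one_apply_eq_self]
  star_mul_of_ne i j hij := by
    ext x
    rw [mul_apply_eq_comp, star_rowComponent_apply, rowComponent_apply,
      U.apply_symm_apply, lp.single_apply_ne _ _ _ hij, zero_apply]
  sum_mul_star := by
    intro _
    ext x
    have h := (lp.hasSum_single (E := fun _ : ι => K) (p := 2) (by norm_num) (U x)).unique
      (hasSum_fintype _)
    simp only [sum_apply, mul_apply_eq_comp,
      star_rowComponent_apply, rowComponent_apply, one_apply_eq_self]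
    rw [← map_sum, ← h, U.symm_apply_apply]

end CuntzDilation

theorem exists_linearIsometry_comp_eq {𝕜 X E F : Type*} [RCLike 𝕜] [AddCommGroup X] [Module 𝕜 X]
    [NormedAddCommGroup E] [NormedSpace 𝕜 E] [NormedAddCommGroup F] [NormedSpace 𝕜 F]
    [CompleteSpace F] {e : X →ₗ[𝕜] E} (he : DenseRange e) (f : X →ₗ[𝕜] F)
    (hf : ∀ x, ‖f x‖ = ‖e x‖) : ∃ C : E →ₗᵢ[𝕜] F, ∀ x, C (e x) = f x := by
  have hC := LinearMap.extendOfNorm_eq (f := f) he ⟨1, fun x => by rw [one_mul, hf]⟩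
  have hnorm : ∀ y, ‖f.extendOfNorm e y‖ = ‖y‖ := fun y =>
    he.induction_on y (isClosed_eq (by fun_prop) continuous_norm) fun x => by rw [hC, hf]
  exact ⟨⟨f.extendOfNorm e, hnorm⟩, hC⟩

/-- The universe of `K` is that of `E`, as the universal property of the Cuntz algebra requires. -/
theorem exists_isCuntzFamily_intertwining {ι : Type} {X : Type*} [AddCommGroup X] [Module ℂ X]
    {E : Type u} [NormedAddCommGroup E] [InnerProductSpace ℂ E] [CompleteSpace E]
    {S : X →ₗ[ℂ] E} (hS : DenseRange S) (B : ι → X →ₗ[ℂ] X)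
    (hB : ∀ x, HasSum (fun i => ‖S (B i x)‖ ^ 2) (‖S x‖ ^ 2)) :
    ∃ (K : Type u) (_ : NormedAddCommGroup K) (_ : InnerProductSpace ℂ K) (_ : CompleteSpace K)
      (J : E →ₗᵢ[ℂ] K) (V : ι → K →L[ℂ] K), IsCuntzFamily V ∧
        ∀ i x, star (V i) (J (S x)) = J (S (B i x)) := by
  classical
  let L : X →ₗ[ℂ] lp (fun _ : ι => E) 2 :=
    lpColumn (fun i => S ∘ₗ B i) fun x => (hB x).summable
  have hL : ∀ x, ‖L x‖ = ‖S x‖ := fun x => norm_lpColumn_of_hasSum (norm_nonneg _) (hB x)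
  obtain ⟨C, hC⟩ := exists_linearIsometry_comp_eq hS L hL
  let J : E →ₗᵢ[ℂ] DilationSpace C :=
    { toFun := fun x => WithLp.toLp 2 (x, 0)
      map_add' := fun x y => by rw [← WithLp.toLp_add, Prod.mk_add_mk, add_zero]
      map_smul' := fun c x => by rw [← WithLp.toLp_smul, Prod.smul_mk, smul_zero]; rfl
      norm_map' := fun x => by simp }
  refine ⟨DilationSpace C, _, _, inferInstance, J, _,
    isCuntzFamily_rowComponent (dilationEquiv C), fun i x => ?_⟩
  rw [star_rowComponent_apply]
  refine (dilationEquiv_toLp_zero C (S x) i).trans ?_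
  rw [hC]
  rfl

theorem adjoint_lp_single_apply {𝕜 ι : Type*} [RCLike 𝕜] [DecidableEq ι] {E : ι → Type*}
    [∀ i, NormedAddCommGroup (E i)] [∀ i, InnerProductSpace 𝕜 (E i)] [∀ i, CompleteSpace (E i)]
    (i : ι) (x : lp E 2) :
    ContinuousLinearMap.adjoint (lp.singleContinuousLinearMap 𝕜 E 2 i) x = x i := by
  refine ext_inner_right 𝕜 fun y => ?_
  rw [ContinuousLinearMap.adjoint_inner_left, lp.singleContinuousLinearMap_apply,
    lp.inner_single_right]

section CompletelyPositive

open ContinuousLinearMap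

variable {k H K : Type*} [Fintype k]
  [NormedAddCommGroup H] [InnerProductSpace ℂ H] [CompleteSpace H]
  [NormedAddCommGroup K] [InnerProductSpace ℂ K] [CompleteSpace K]

/-- Instance search for the real functional calculus fails when
`CStarAlgebra.nonneg_iff_eq_star_mul_self` is applied to `CStarMatrix k k (K →L[ℂ] K)` itself. -/
theorem exists_eq_star_mul_self_of_nonneg {B : Type*} [NonUnitalCStarAlgebra B] [PartialOrder B]
    [StarOrderedRing B] {a : B} (ha : 0 ≤ a) : ∃ y, a = star y * y :=
  CStarAlgebra.nonneg_iff_eq_star_mul_self.1 ha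

theorem cstarMatrix_gram_nonneg (Z : k → H →L[ℂ] K) :
    0 ≤ CStarMatrix.ofMatrix fun i j => adjoint (Z i) ∘L Z j := by
  classical
  let e (i : k) : H →L[ℂ] lp (fun _ : k => H) 2 :=
    lp.singleContinuousLinearMap ℂ (fun _ => H) 2 i
  have he : ∀ i x, adjoint (e i) x = x i := adjoint_lp_single_apply
  let R : lp (fun _ : k => H) 2 →L[ℂ] K := ∑ j, Z j ∘L adjoint (e j)
  have hR : ∀ j h, R (e j h) = Z j h := fun j h => by
    simp only [R, sum_apply, comp_apply, he]
    rw [Finset.sum_eq_single_of_mem j (Finset.mem_univ j) fun i _ hij => ?_]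
    · exact congrArg (Z j) (lp.single_apply_self (E := fun _ => H) 2 j h)
    · exact (congrArg (Z i) (lp.single_apply_ne (E := fun _ => H) 2 j h hij)).trans (map_zero _)
  obtain ⟨T, hT⟩ := exists_eq_star_mul_self_of_nonneg
    ((nonneg_iff_isPositive _).2 (isPositive_adjoint_comp_self R))
  let N : CStarMatrix k k (H →L[ℂ] H) := CStarMatrix.ofMatrix fun l j => adjoint (e l) ∘L T ∘L e j
  have hN : ∀ l j h, N l j h = T (e j h) l := fun l j h => he l (T (e j h))
  suffices h : (CStarMatrix.ofMatrix fun i j => adjoint (Z i) ∘L Z j) = star N * N by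
    rw [h]
    exact star_mul_self_nonneg N
  ext i j h
  refine ext_inner_left ℂ fun g => ?_
  calc ⟪g, adjoint (Z i) (Z j h)⟫_ℂ
      = ⟪e i g, (adjoint R ∘L R) (e j h)⟫_ℂ := by
        rw [adjoint_inner_right, comp_apply, adjoint_inner_right, hR, hR]
    _ = ⟪T (e i g), T (e j h)⟫_ℂ := by
        rw [hT, mul_apply_eq_comp, star_eq_adjoint, adjoint_inner_right]
    _ = ∑ l, ⟪N l i g, N l j h⟫_ℂ := by
        simp only [lp.inner_eq_tsum, tsum_fintype, hN]
    _ = ⟪g, (star N * N) i j h⟫_ℂ := by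
        simp only [CStarMatrix.mul_apply, CStarMatrix.star_apply, sum_apply, inner_sum,
          mul_apply_eq_comp, star_eq_adjoint, adjoint_inner_right]

theorem cstarMatrix_map_compression_nonneg (R : H →L[ℂ] K) {M : CStarMatrix k k (K →L[ℂ] K)}
    (hM : 0 ≤ M) : 0 ≤ M.map fun X => adjoint R ∘L X ∘L R := by
  obtain ⟨Y, rfl⟩ := exists_eq_star_mul_self_of_nonneg hM
  suffices h : (star Y * Y).map (fun X => adjoint R ∘L X ∘L R) =
      ∑ l, CStarMatrix.ofMatrix fun i j => adjoint (Y l i ∘L R) ∘L (Y l j ∘L R) by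
    rw [h]
    exact Finset.sum_nonneg fun l _ => cstarMatrix_gram_nonneg fun j => Y l j ∘L R
  refine CStarMatrix.ext fun i j => Eq.trans ?_ (Matrix.sum_apply i j _ _).symm
  simp only [CStarMatrix.map_apply, CStarMatrix.mul_apply, CStarMatrix.star_apply,
    star_eq_adjoint, adjoint_comp, comp_finsetSum, finsetSum_comp]
  rfl

/-- The completely positive map `x ↦ R⋆ π(x) R`. -/
noncomputable def compressionCP {B : Type*} [CStarAlgebra B] [PartialOrder B]
    [StarOrderedRing B] (π : B →⋆ₐ[ℂ] (K →L[ℂ] K)) (R : H →L[ℂ] K) : B →CP (H →L[ℂ] H) where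
  toFun x := adjoint R ∘L π x ∘L R
  map_add' x y := by rw [map_add, add_comp, comp_add]
  map_smul' c x := by rw [map_smul, smul_comp, comp_smul, RingHom.id_apply]
  map_cstarMatrix_nonneg' k M hM :=
    cstarMatrix_map_compression_nonneg R
      (CompletelyPositiveMapClass.map_cstarMatrix_nonneg' π k M hM)

theorem compressionCP_apply {B : Type*} [CStarAlgebra B] [PartialOrder B]
    [StarOrderedRing B] (π : B →⋆ₐ[ℂ] (K →L[ℂ] K)) (R : H →L[ℂ] K) (x : B) :
    compressionCP π R x = adjoint R ∘L π x ∘L R := rfl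

end CompletelyPositive

section WordProd

variable {ι M : Type*} [Monoid M]

theorem wordProd_one (T : ι → M) : wordProd T 1 = 1 :=
  map_one (FreeMonoid.lift T)

theorem wordProd_mul (T : ι → M) (α β : FreeMonoid ι) :
    wordProd T (α * β) = wordProd T α * wordProd T β :=
  map_mul (FreeMonoid.lift T) α β

theorem wordProd_of (T : ι → M) (i : ι) : wordProd T (FreeMonoid.of i) = T i :=
  FreeMonoid.lift_eval_of T i

theorem map_wordProd {N F : Type*} [Monoid N] [FunLike F M N] [MonoidHomClass F M N]
    (f : F) (T : ι → M) (α : FreeMonoid ι) : f (wordProd T α) = wordProd (fun i => f (T i)) α :=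
  DFunLike.congr_fun (FreeMonoid.comp_lift (f : M →* N) T) α

end WordProd

/-- The linear span of the `v_α v_β⋆`. -/
def wordSpan {ι B : Type*} [Semiring B] [StarRing B] [Algebra ℂ B] (v : ι → B) : Submodule ℂ B :=
  Submodule.span ℂ
    (Set.range fun p : FreeMonoid ι × FreeMonoid ι => wordProd v p.1 * star (wordProd v p.2))

section WordSpan

variable {ι B : Type*} [Semiring B] [StarRing B] [Algebra ℂ B] {v : ι → B}

theorem wordProd_mul_star_mem_wordSpan (α β : FreeMonoid ι) :
    wordProd v α * star (wordProd v β) ∈ wordSpan v :=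
  Submodule.subset_span ⟨(α, β), rfl⟩

theorem wordProd_mem_wordSpan (α : FreeMonoid ι) : wordProd v α ∈ wordSpan v := by
  simpa only [wordProd_one, star_one, mul_one] using wordProd_mul_star_mem_wordSpan (v := v) α 1

theorem star_mem_wordSpan [StarModule ℂ B] {x : B} (hx : x ∈ wordSpan v) : star x ∈ wordSpan v := by
  induction hx using Submodule.span_induction with
  | mem x hx =>
    obtain ⟨⟨α, β⟩, rfl⟩ := hx
    simpa only [star_mul, star_star] using wordProd_mul_star_mem_wordSpan (v := v) β α
  | zero => simpa only [star_zero] using zero_mem (wordSpan v)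
  | add x y _ _ hx hy => simpa only [star_add] using add_mem hx hy
  | smul c x _ hx => simpa only [star_smul] using Submodule.smul_mem (wordSpan v) (star c) hx

end WordSpan

namespace IsCuntzFamily

variable {ι : Type} {B : Type*} [CStarAlgebra B] {v : ι → B}

theorem star_wordProd_mul_wordProd (hv : IsCuntzFamily v) (α β : FreeMonoid ι) :
    star (wordProd v α) * wordProd v β = 0 ∨
      (∃ γ, star (wordProd v α) * wordProd v β = wordProd v γ) ∨
      ∃ γ, star (wordProd v α) * wordProd v β = star (wordProd v γ) := by
  induction α using FreeMonoid.inductionOn' generalizing β with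
  | one => exact .inr (.inl ⟨β, by rw [wordProd_one, star_one, one_mul]⟩)
  | of_mul i α ih =>
    cases β using FreeMonoid.casesOn with
    | one => exact .inr (.inr ⟨.of i * α, by rw [wordProd_one, mul_one]⟩)
    | of_mul j β =>
      have hcancel : star (wordProd v (.of i * α)) * wordProd v (.of j * β) =
          star (wordProd v α) * (star (v i) * v j) * wordProd v β := by
        simp only [wordProd_mul, wordProd_of, star_mul, mul_assoc]
      rw [hcancel]
      rcases eq_or_ne i j with rfl | hij
      · rw [hv.star_mul_self, mul_one]
        exact ih β
      · rw [hv.star_mul_of_ne i j hij, mul_zero, zero_mul]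
        exact .inl rfl

theorem mul_mem_wordSpan (hv : IsCuntzFamily v) {x y : B} (hx : x ∈ wordSpan v)
    (hy : y ∈ wordSpan v) : x * y ∈ wordSpan v := by
  have hxy := Submodule.mul_mem_mul hx hy
  rw [wordSpan, Submodule.span_mul_span] at hxy
  refine Submodule.span_le.2 ?_ hxy
  rintro _ ⟨_, ⟨⟨α, β⟩, rfl⟩, _, ⟨⟨γ, δ⟩, rfl⟩, rfl⟩
  change wordProd v α * star (wordProd v β) * (wordProd v γ * star (wordProd v δ)) ∈ wordSpan v
  rw [mul_assoc, ← mul_assoc (star _), ← mul_assoc]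
  rcases hv.star_wordProd_mul_wordProd β γ with h | ⟨ε, h⟩ | ⟨ε, h⟩
  · rw [h, mul_zero, zero_mul]
    exact zero_mem _
  · rw [h, ← wordProd_mul]
    exact wordProd_mul_star_mem_wordSpan _ _
  · rw [h, mul_assoc, ← star_mul, ← wordProd_mul]
    exact wordProd_mul_star_mem_wordSpan _ _

theorem mem_wordSpan_of_mem_adjoin (hv : IsCuntzFamily v) {x : B}
    (hx : x ∈ StarAlgebra.adjoin ℂ (Set.range v)) : x ∈ wordSpan v := by
  induction hx using StarAlgebra.adjoin_induction with
  | mem x hx =>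
    obtain ⟨i, rfl⟩ := hx
    exact wordProd_of v i ▸ wordProd_mem_wordSpan _
  | algebraMap r =>
    rw [Algebra.algebraMap_eq_smul_one, ← wordProd_one v]
    exact Submodule.smul_mem _ _ (wordProd_mem_wordSpan 1)
  | add x y _ _ hx hy => exact add_mem hx hy
  | mul x y _ _ hx hy => exact hv.mul_mem_wordSpan hx hy
  | star x _ hx => exact star_mem_wordSpan hx

end IsCuntzFamily

theorem CuntzAlgebra.dense_wordSpan (ι : Type) :
    Dense (wordSpan (CuntzAlgebra.v.{u} (ι := ι)) : Set (CuntzAlgebra.{u} ι)) := by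
  have hadjoin : Dense (StarAlgebra.adjoin ℂ (Set.range (CuntzAlgebra.v.{u} (ι := ι))) :
      Set (CuntzAlgebra.{u} ι)) := by
    rw [dense_iff_closure_eq, ← StarSubalgebra.topologicalClosure_coe, topologicalClosure_adjoin_v,
      StarSubalgebra.coe_top]
  exact hadjoin.mono fun _ => (isCuntzFamily_v ι).mem_wordSpan_of_mem_adjoin

theorem CuntzAlgebra.linearMap_eq_of_wordProd {ι : Type} {F E : Type*} [AddCommMonoid E]
    [Module ℂ E] [TopologicalSpace E] [T2Space E] [FunLike F (CuntzAlgebra.{u} ι) E]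
    [LinearMapClass F ℂ (CuntzAlgebra.{u} ι) E] {f g : F} (hf : Continuous f) (hg : Continuous g)
    (h : ∀ α β : FreeMonoid ι, f (wordProd CuntzAlgebra.v α * star (wordProd CuntzAlgebra.v β)) =
      g (wordProd CuntzAlgebra.v α * star (wordProd CuntzAlgebra.v β))) : f = g := by
  refine DFunLike.coe_injective (hf.ext_on (CuntzAlgebra.dense_wordSpan ι) hg ?_)
  refine LinearMap.eqOn_span (f := (f : CuntzAlgebra.{u} ι →ₗ[ℂ] E)) (g := (g : _ →ₗ[ℂ] E)) ?_
  rintro _ ⟨⟨α, β⟩, rfl⟩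
  exact h α β

theorem HasUltraweakSum.hasSum_inner {ι H : Type*} [NormedAddCommGroup H] [InnerProductSpace ℂ H]
    {f : ι → H →L[ℂ] H} {s : H →L[ℂ] H} (h : HasUltraweakSum f s) (x y : H) :
    HasSum (fun i => ⟪y, f i x⟫_ℂ) ⟪y, s x⟫_ℂ := by
  have hs : ∀ T : H →L[ℂ] H, ∑' k, ⟪lp.single (E := fun _ : ℕ => H) 2 0 y k,
      T (lp.single (E := fun _ : ℕ => H) 2 0 x k)⟫_ℂ = ⟪y, T x⟫_ℂ := fun T => by
    rw [tsum_eq_single 0, lp.single_apply_self, lp.single_apply_self]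
    intro k hk
    rw [lp.single_apply_ne _ _ _ hk, inner_zero_left]
  simpa only [hs] using h (lp.single 2 0 x) (lp.single 2 0 y)

section Existence

open ContinuousLinearMap

theorem star_wordProd_apply_of_intertwining {ι H K : Type*} [NormedAddCommGroup H]
    [InnerProductSpace ℂ H] [CompleteSpace H] [NormedAddCommGroup K] [InnerProductSpace ℂ K]
    [CompleteSpace K] {A : ι → H →L[ℂ] H} {V : ι → K →L[ℂ] K} {R : H →L[ℂ] K}
    (hR : ∀ i h, star (V i) (R h) = R (star (A i) h)) (α : FreeMonoid ι) (h : H) :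
    star (wordProd V α) (R h) = R (star (wordProd A α) h) := by
  induction α using FreeMonoid.inductionOn' generalizing h with
  | one => simp only [wordProd_one, star_one, one_apply_eq_self]
  | of_mul i α ih => simp only [wordProd_mul, wordProd_of, star_mul, mul_apply_eq_comp, hR, ih]

variable {ι : Type} {H : Type u} [NormedAddCommGroup H] [InnerProductSpace ℂ H] [CompleteSpace H]
  {A : ι → H →L[ℂ] H}

theorem exists_completelyPositiveMap_of_intertwining {K : Type u} [NormedAddCommGroup K]
    [InnerProductSpace ℂ K] [CompleteSpace K] {V : ι → K →L[ℂ] K} (hV : IsCuntzFamily V)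
    {R : H →L[ℂ] K} (hR : ∀ i h, star (V i) (R h) = R (star (A i) h)) :
    ∃ Φ : CuntzAlgebra.{u} ι →CP (H →L[ℂ] H), ∀ α β : FreeMonoid ι,
      Φ (wordProd CuntzAlgebra.v α * star (wordProd CuntzAlgebra.v β)) =
        wordProd A α * (adjoint R ∘L R) * star (wordProd A β) := by
  obtain ⟨π, hπ, -⟩ := CuntzAlgebra.existsUnique_lift V hV
  have hπα : ∀ α, π (wordProd CuntzAlgebra.v α) = wordProd V α := fun α => by
    rw [map_wordProd, funext hπ]
  have hRα := star_wordProd_apply_of_intertwining hR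
  refine ⟨compressionCP π R, fun α β => ContinuousLinearMap.ext fun h => ?_⟩
  refine ext_inner_left ℂ fun g => ?_
  calc ⟪g, compressionCP π R (wordProd CuntzAlgebra.v α * star (wordProd CuntzAlgebra.v β)) h⟫_ℂ
      = ⟪star (wordProd V α) (R g), star (wordProd V β) (R h)⟫_ℂ := by
        rw [compressionCP_apply, map_mul, map_star, hπα, hπα, comp_apply, adjoint_inner_right,
          star_eq_adjoint (wordProd V α), adjoint_inner_left]
        rfl
    _ = ⟪g, (wordProd A α * (adjoint R ∘L R) * star (wordProd A β)) h⟫_ℂ := by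
        rw [hRα, hRα, star_eq_adjoint (wordProd A α), ← adjoint_inner_right, adjoint_inner_left]
        rfl

theorem inner_sqrt_apply_sqrt_apply {D : H →L[ℂ] H} (hD : 0 ≤ D) (x y : H) :
    ⟪CFC.sqrt D x, CFC.sqrt D y⟫_ℂ = ⟪x, D y⟫_ℂ := by
  have hsa : adjoint (CFC.sqrt D) = CFC.sqrt D := (CFC.sqrt_nonneg D).isSelfAdjoint
  rw [← adjoint_inner_right, hsa, ← mul_apply_eq_comp, CFC.sqrt_mul_sqrt_self D hD]

theorem hasSum_norm_sq_sqrt_star_apply {D : H →L[ℂ] H} (hD : 0 ≤ D)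
    (hA : HasUltraweakSum (fun i => A i * D * star (A i)) D) (x : H) :
    HasSum (fun i => ‖CFC.sqrt D (star (A i) x)‖ ^ 2) (‖CFC.sqrt D x‖ ^ 2) := by
  have hnorm (y : H) : ((‖CFC.sqrt D y‖ ^ 2 : ℝ) : ℂ) = ⟪y, D y⟫_ℂ := by
    rw [← inner_sqrt_apply_sqrt_apply hD, Complex.ofReal_pow]
    exact (inner_self_eq_norm_sq_to_K (𝕜 := ℂ) (CFC.sqrt D y)).symm
  rw [← Complex.hasSum_ofReal, hnorm]
  refine (hA.hasSum_inner x x).congr_fun fun i => ?_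
  rw [hnorm, star_eq_adjoint, adjoint_inner_left]
  rfl

theorem exists_completelyPositiveMap_of_hasUltraweakSum {D : H →L[ℂ] H} (hD : 0 ≤ D)
    (hA : HasUltraweakSum (fun i => A i * D * star (A i)) D) :
    ∃ Φ : CuntzAlgebra.{u} ι →CP (H →L[ℂ] H), ∀ α β : FreeMonoid ι,
      Φ (wordProd CuntzAlgebra.v α * star (wordProd CuntzAlgebra.v β)) =
        wordProd A α * D * star (wordProd A β) := by
  let E : Submodule ℂ H := (LinearMap.range (CFC.sqrt D).toLinearMap).topologicalClosure
  have : CompleteSpace E := Submodule.topologicalClosure.completeSpace _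
  let S : H →L[ℂ] E := (CFC.sqrt D).codRestrict E fun x =>
    Submodule.le_topologicalClosure _ (LinearMap.mem_range_self _ x)
  have hS : DenseRange S := fun y => closure_subtype.2 <| by
    rw [← Set.range_comp]
    exact y.2
  obtain ⟨K, _, _, _, J, V, hV, hJ⟩ := exists_isCuntzFamily_intertwining (S := S.toLinearMap) hS
    (fun i => (star (A i)).toLinearMap) (hasSum_norm_sq_sqrt_star_apply hD hA)
  let R : H →L[ℂ] K := J.toContinuousLinearMap ∘L S
  have hRD : adjoint R ∘L R = D := by
    refine ContinuousLinearMap.ext fun h => ext_inner_left ℂ fun g => ?_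
    rw [comp_apply, adjoint_inner_right, ← inner_sqrt_apply_sqrt_apply hD]
    exact J.inner_map_map (S g) (S h)
  simpa only [hRD] using exists_completelyPositiveMap_of_intertwining hV (R := R) hJ

end Existence

theorem theorem2p3_general {ι : Type}
    {H : Type u} [NormedAddCommGroup H] [InnerProductSpace ℂ H] [CompleteSpace H]
    (A : ι → H →L[ℂ] H) {D : H →L[ℂ] H} (hD : 0 ≤ D)
    (hA : HasUltraweakSum (fun i => A i * D * star (A i)) D) :
    ∃! Φ : CuntzAlgebra.{u} ι →CP (H →L[ℂ] H),
      Φ 1 = D ∧ ∀ α β : FreeMonoid ι,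
        Φ (wordProd CuntzAlgebra.v α * star (wordProd CuntzAlgebra.v β)) =
          wordProd A α * D * star (wordProd A β) := by
  obtain ⟨Φ, hΦ⟩ := exists_completelyPositiveMap_of_hasUltraweakSum hD hA
  refine ⟨Φ, ⟨?_, hΦ⟩, fun Ψ hΨ => ?_⟩
  · simpa only [wordProd_one, star_one, mul_one, one_mul] using hΦ 1 1
  · exact CuntzAlgebra.linearMap_eq_of_wordProd (map_continuous Ψ) (map_continuous Φ)
      fun α β => (hΨ.2 α β).trans (hΦ α β).symm

/-- `n = card ι` runs over `2, 3, …, ∞`.  A map `φ` given by `φ(X) = ∑ᵢ Aᵢ X Aᵢ⋆` (w⋆-convergent for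
every `X`) is automatically linear, completely positive and w⋆-continuous. -/
theorem theorem2p3 {ι : Type} [Countable ι] [Nontrivial ι]
    {H : Type u} [NormedAddCommGroup H] [InnerProductSpace ℂ H] [CompleteSpace H]
    [TopologicalSpace.SeparableSpace H]
    (A : ι → H →L[ℂ] H) (φ : (H →L[ℂ] H) → (H →L[ℂ] H))
    (hφ : ∀ X : H →L[ℂ] H, HasUltraweakSum (fun i => A i * X * star (A i)) (φ X)) :
    (∀ D : H →L[ℂ] H, 0 ≤ D → IsUnit D → φ D = D →
      ∃! Φ : CuntzAlgebra.{u} ι →CP (H →L[ℂ] H),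
        Φ 1 = D ∧ ∀ α β : FreeMonoid ι,
          Φ (wordProd CuntzAlgebra.v α * star (wordProd CuntzAlgebra.v β)) =
            wordProd A α * D * star (wordProd A β)) ∧
    (φ 1 = 1 → ∀ D : H →L[ℂ] H, 0 ≤ D → φ D = D →
      ∃! Φ : CuntzAlgebra.{u} ι →CP (H →L[ℂ] H),
        Φ 1 = D ∧ ∀ α β : FreeMonoid ι,
          Φ (wordProd CuntzAlgebra.v α * star (wordProd CuntzAlgebra.v β)) =
            wordProd A α * D * star (wordProd A β)) :=
  ⟨fun D hD _ hDφ => theorem2p3_general A hD (by simpa only [hDφ] using hφ D),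
    fun _ D hD hDφ => theorem2p3_general A hD (by simpa only [hDφ] using hφ D)⟩
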